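/- Let $d, N$ be non-negative integers and write $\langle z\rangle=(1+|x|^2+|\xi|^2)^{1/2}$ for $z=(x,\xi)\in\mathbb{R}^{2d}$. Let $\Phi:\mathbb{R}^{2d}\to\mathbb{R}$, $\Phi=\Phi(x,\eta)$, be a phase function such that (i) $\Phi\in C^\infty(\mathbb{R}^{2d})$; (ii) for every multi-index $\alpha$ with $|\alpha|\ge 2$ there is a constant $C_\alpha$ with $|\partial_z^\alpha\Phi(z)|\le C_\alpha$ for all $z\in\mathbb{R}^{2d}$; (iii) there is $\delta>0$ with $|\det\partial^2_{x,\eta}\Phi(x,\eta)|\ge\delta$ for all $(x,\eta)\in\mathbb{R}^{2d}$. Let $\sigma\in L^\infty(\mathbb{R}^{2d})$ be a complex-valued symbol all of whose distributional derivatives $\partial_z^\alpha\sigma$ with $|\alpha|\le 2N$ belong to $L^\infty(\mathbb{R}^{2d})$, and let $T$ be the Fourier integral operator $$Tf(x)=\int_{\mathbb{R}^d}e^{2\pi i\Phi(x,\eta)}\sigma(x,\eta)\hat f(\eta)\,d\eta,\qquad \hat f(\eta)=\int_{\mathbb{R}^d}f(t)e^{-2\pi i t\cdot\eta}\,dt .$$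 Let $g\in\mathcal{S}(\mathbb{R}^d)$, let $a,b>0$, let $\Lambda=a\mathbb{Z}^d\times b\mathbb{Z}^d$, and for $(m,n)\in\Lambda$ put $g_{m,n}(t)=e^{2\pi i n\cdot t}g(t-m)$. (In particular, $g$ may generate a tight Gabor frame $\{g_{m,n}\}_{(m,n)\in\Lambda}$ of $L^2(\mathbb{R}^d)$.) Then the system $$y=\nabla_\eta\Phi(x,\eta),\qquad \xi=\nabla_x\Phi(x,\eta)$$ has, for every $(y,\eta)\in\mathbb{R}^{2d}$, exactly one solution $(x,\xi)=:\chi(y,\eta)$. The map $\chi$ (the canonical transformation generated by $\Phi$) is a smooth diffeomorphism of $\mathbb{R}^{2d}$, $\chi$ and $\chi^{-1}$ are Lipschitz continuous, and $\chi$ preserves the symplectic form, $dx\wedge d\xi=dy\wedge d\eta$. Moreover there is a constant $C_N>0$ such that $$|\langle Tg_{m,n},g_{m',n'}\rangle|\le C_N\,\langle\chi(m,n)-(m',n')\rangle^{-2N}\qquad\text{for all }(m,n),(m',n')\in\Lambda,$$ where $\langle f,h\rangle=\int_{\mathbb{R}^d} f(t)\overline{h(t)}\,dt$. -/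

import Mathlib

open MeasureTheory FourierTransform
open scoped ContDiff

noncomputable section

namespace FourierOp

/-- The Euclidean space `ℝ^d`. -/
abbrev Eu (d : ℕ) : Type := EuclideanSpace ℝ (Fin d)

/-- The space `ℝ^{2d} = ℝ^d × ℝ^d`, with Lebesgue (product) measure. -/
abbrev Phase (d : ℕ) : Type := Eu d × Eu d

/-- `⟨(x, ξ)⟩ = (1 + |x|² + |ξ|²)^{1/2}`, with Euclidean norms. -/
def bracket {d : ℕ} (p : Phase d) : ℝ :=
  Real.sqrt (1 + ‖p.1‖ ^ 2 + ‖p.2‖ ^ 2)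

/-- The standard basis vector `e_i` of `ℝ^d`. -/
def stdVec {d : ℕ} (i : Fin d) : Eu d := EuclideanSpace.single i (1 : ℝ)

/-- The standard basis of `ℝ^{2d}`: `inl i` is the direction of `x_i`, `inr j` that of `η_j`. -/
def phaseVec {d : ℕ} : Fin d ⊕ Fin d → Phase d
  | Sum.inl i => (stdVec i, 0)
  | Sum.inr j => (0, stdVec j)

/-! ### The phase function -/

/-- The gradient `∇_x Φ (x, η)` in the first variable. -/
def gradX {d : ℕ} (Φ : Phase d → ℝ) (x η : Eu d) : Eu d :=
  gradient (fun x' : Eu d => Φ (x', η)) x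

/-- The gradient `∇_η Φ (x, η)` in the second variable. -/
def gradEta {d : ℕ} (Φ : Phase d → ℝ) (x η : Eu d) : Eu d :=
  gradient (fun η' : Eu d => Φ (x, η')) η

/-- The matrix `∂²_{x,η} Φ (z) = (∂_{x_i} ∂_{η_j} Φ (z))_{i,j}`. -/
def mixedHessian {d : ℕ} (Φ : Phase d → ℝ) (z : Phase d) : Matrix (Fin d) (Fin d) ℝ :=
  Matrix.of fun i j =>
    fderiv ℝ (fun w : Phase d => fderiv ℝ Φ w (phaseVec (Sum.inr j))) z (phaseVec (Sum.inl i))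

/-- The phase functions: smooth, real-valued, with all derivatives of order at least two bounded,
and with `|det ∂²_{x,η} Φ| ≥ δ` everywhere for some `δ > 0`. -/
structure IsPhase {d : ℕ} (Φ : Phase d → ℝ) : Prop where
  smooth : ContDiff ℝ ∞ Φ
  bounded : ∀ k : ℕ, 2 ≤ k → ∃ C : ℝ, ∀ z : Phase d, ‖iteratedFDeriv ℝ k Φ z‖ ≤ C
  nondegenerate : ∃ δ : ℝ, 0 < δ ∧ ∀ z : Phase d, δ ≤ |(mixedHessian Φ z).det|

/-! ### The symbol -/

/-- `w` is the distributional derivative `∂_{I 0} ⋯ ∂_{I (k-1)} σ` on `ℝ^{2d}`, where each `I j` is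
one of the `2d` coordinate directions. (As `I` varies these are the `∂^α σ` with `|α| = k`.) -/
def IsWeakPartial {d k : ℕ} (I : Fin k → Fin d ⊕ Fin d) (σ w : Phase d → ℂ) : Prop :=
  ∀ φ : Phase d → ℂ, ContDiff ℝ ∞ φ → HasCompactSupport φ →
    ∫ z, σ z * iteratedFDeriv ℝ k φ z (fun j => phaseVec (I j)) = (-1) ^ k * ∫ z, w z * φ z

/-- `σ` is (measurable and) essentially bounded, and all its distributional derivatives of order
at most `K` are essentially bounded functions. -/
def IsSymbol {d : ℕ} (K : ℕ) (σ : Phase d → ℂ) : Prop :=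
  MemLp σ ⊤ volume ∧
    ∀ k : ℕ, k ≤ K → ∀ I : Fin k → Fin d ⊕ Fin d,
      ∃ w : Phase d → ℂ, MemLp w ⊤ volume ∧ IsWeakPartial I σ w

/-! ### The operator and the Gabor system -/

/-- The Fourier integral operator
`T f (x) = ∫ e^{2πi Φ(x,η)} σ(x,η) f̂(η) dη`, with `f̂(η) = ∫ f(t) e^{-2πi t·η} dt`. -/
def fio {d : ℕ} (Φ : Phase d → ℝ) (σ : Phase d → ℂ) (f : Eu d → ℂ) (x : Eu d) : ℂ :=
  ∫ η : Eu d, Complex.exp (2 * Real.pi * Complex.I * (Φ (x, η) : ℂ)) * σ (x, η) * 𝓕 f η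

/-- The time-frequency shift `g_{m,n} = M_n T_m g`, that is `t ↦ e^{2πi n·t} g(t - m)`. -/
def gaborAtom {d : ℕ} (g : Eu d → ℂ) (m n : Eu d) (t : Eu d) : ℂ :=
  Complex.exp (2 * Real.pi * Complex.I * (inner ℝ n t : ℂ)) * g (t - m)

/-- The pairing `⟨f, h⟩ = ∫ f(t) conj(h(t)) dt`. -/
def pairing {d : ℕ} (f h : Eu d → ℂ) : ℂ :=
  ∫ t : Eu d, f t * (starRingEnd ℂ) (h t)

/-- The lattice `Λ = a ℤ^d × b ℤ^d` in `ℝ^{2d}`. -/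
def gaborLattice (d : ℕ) (a b : ℝ) : Set (Phase d) :=
  {p | (∀ i : Fin d, ∃ k : ℤ, p.1 i = a * k) ∧ ∀ i : Fin d, ∃ k : ℤ, p.2 i = b * k}

/-! ### Canonical transformations -/

/-- The symplectic form `dx ∧ dξ = ∑_j dx_j ∧ dξ_j` on `ℝ^{2d}`. -/
def symplecticForm {d : ℕ} (u v : Phase d) : ℝ :=
  inner ℝ u.1 v.2 - inner ℝ u.2 v.1

/-- A smooth bilipschitz canonical transformation of `ℝ^{2d}`: a smooth diffeomorphism, Lipschitz
together with its inverse, which preserves the symplectic form. -/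
structure IsCanonicalTransformation {d : ℕ} (χ : Phase d ≃ Phase d) : Prop where
  smooth : ContDiff ℝ ∞ χ
  smooth_symm : ContDiff ℝ ∞ χ.symm
  lipschitz : ∃ K : NNReal, LipschitzWith K χ
  lipschitz_symm : ∃ K : NNReal, LipschitzWith K χ.symm
  symplectic : ∀ p u v : Phase d,
    symplecticForm (fderiv ℝ χ p u) (fderiv ℝ χ p v) = symplecticForm u v

/-- `χ` is generated by `Φ`: `χ (y, η) = (x, ξ)` is the solution of the system
`y = ∇_η Φ (x, η)`, `ξ = ∇_x Φ (x, η)` with respect to `(x, ξ)`.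
At most one map `χ` has this property. -/
def IsGeneratedBy {d : ℕ} (Φ : Phase d → ℝ) (χ : Phase d → Phase d) : Prop :=
  ∀ y η x ξ : Eu d, χ (y, η) = (x, ξ) ↔ y = gradEta Φ x η ∧ ξ = gradX Φ x η

end FourierOp

end

/-!
Since the Jacobians of `(x, η) ↦ (∇_η Φ, η)` and `(x, η) ↦ (x, ∇_x Φ)` both have determinant
`det ∂²_{x,η} Φ`, which is bounded away from zero, and their higher derivatives are bounded, these
two maps are local diffeomorphisms with a uniform radius of injectivity and a uniform radius of
surjectivity. Hence they are covering maps of a simply connected space, that is, global bilipschitz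
diffeomorphisms. The canonical transformation is the second one composed with the inverse of the
first; that it preserves the symplectic form is the symmetry of the Hessian of `Φ`.

Up to a unimodular factor, the matrix coefficient is an oscillatory integral over phase space
against `σ`. Splitting off the linear part of `Φ` at `(m', n)` leaves an amplitude whose derivatives
are integrable uniformly in the parameters, and a linear phase with coefficients
`(∇_x Φ (m', n) - n', ∇_η Φ (m', n) - m)`. Integrating by parts in each coordinate direction, with
the derivatives falling on `σ` in the weak sense, bounds the powers of these coefficients times the
matrix coefficient. As `χ (∇_η Φ (m', n), n) = (m', ∇_x Φ (m', n))` and `χ` is Lipschitz, the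
coefficients control the distance from `χ (m, n)` to `(m', n')`.
-/

namespace FourierOp

section GlobalInverse

open Set Metric Function Topology
open scoped NNReal

theorem isCoveringMap_of_surjOn_ball {X Y : Type*} [MetricSpace X] [PseudoMetricSpace Y] {f : X → Y}
    {r ρ : ℝ} (hρ : 0 < ρ) (hf : Continuous f) (hopen : IsOpenMap f)
    (hinj : ∀ x, InjOn f (ball x (2 * r))) (hsurj : ∀ x, SurjOn f (ball x r) (ball (f x) ρ)) :
    IsCoveringMap f := by
  intro y
  rcases isEmpty_or_nonempty (f ⁻¹' {y}) with hy | hy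
  · refine IsEvenlyCovered.of_preimage_eq_empty _ (ball_mem_nhds y hρ)
      (eq_empty_of_forall_notMem fun z hz => ?_)
    obtain ⟨x, -, hx⟩ := hsurj z (mem_ball_comm.1 hz)
    exact hy.elim ⟨x, hx⟩
  obtain ⟨x₀⟩ := id hy
  have hr : 0 < r := by
    obtain ⟨x, hx, -⟩ := hsurj x₀ (mem_ball_self hρ)
    exact pos_of_mem_ball hx
  have hdisj : Pairwise (Disjoint on fun x : f ⁻¹' {y} => ball (x : X) r) := by
    refine fun x x' hne => ball_disjoint_ball (le_of_not_gt fun hlt => hne (Subtype.ext ?_))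
    refine hinj x (mem_ball_self (by positivity)) ?_ (x.2.trans x'.2.symm)
    rw [mem_ball_comm, mem_ball]
    linarith
  have hsurj' (x : f ⁻¹' {y}) : SurjOn f (ball x r) (ball y ρ) := by
    have hx : f x = y := x.2
    simpa only [hx] using hsurj x
  have hcover : f ⁻¹' ball y ρ ⊆ ⋃ x : f ⁻¹' {y}, ball (x : X) r := fun z hz => by
    obtain ⟨x, hx, hxy⟩ := hsurj z (mem_ball_comm.1 hz)
    exact mem_iUnion.2 ⟨⟨x, hxy⟩, mem_ball_comm.1 hx⟩
  have hdiscrete : DiscreteTopology (f ⁻¹' {y}) := by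
    refine discreteTopology_iff_isOpen_singleton.2 fun x =>
      ⟨ball x r, isOpen_ball, eq_singleton_iff_unique_mem.2 ⟨mem_ball_self hr, fun x' hx' => ?_⟩⟩
    by_contra hne
    exact disjoint_left.1 (hdisj hne) (mem_ball_self hr) hx'
  have : Nonempty X := ⟨x₀⟩
  refine .of_trivialization (t := isOpen_ball.trivializationDiscrete _ (ball y ρ)
    (fun x W hW => ⟨fun h => (h.preimage hf).inter isOpen_ball, fun h => ?_⟩)
    (fun x => (hinj x).mono (ball_subset_ball (by linarith))) hsurj' hdisj hcover)
    (mem_ball_self hρ)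
  have himage : f '' (f ⁻¹' W ∩ ball x r) = W := by
    rw [image_preimage_inter, inter_eq_left]
    exact hW.trans (hsurj' x)
  exact himage ▸ hopen _ h

theorem exists_homeomorph_of_isCoveringMap {X Y : Type*} [TopologicalSpace X] [TopologicalSpace Y]
    [PreconnectedSpace X] [Nonempty X] [SimplyConnectedSpace Y] [LocallyPathConnectedSpace Y]
    {f : X → Y} (hf : IsCoveringMap f) : ∃ e : X ≃ₜ Y, ⇑e = f := by
  obtain ⟨x₀⟩ := ‹Nonempty X›
  obtain ⟨s, ⟨hs₀, hs⟩, -⟩ :=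
    hf.existsUnique_continuousMap_lifts (ContinuousMap.id Y) (f x₀) x₀ rfl
  have hfs : RightInverse s f := congrFun hs
  have hsf : s ∘ f = id :=
    hf.eq_of_comp_eq (s.continuous.comp hf.continuous) continuous_id
      (funext fun x => hfs (f x)) x₀ hs₀
  exact ⟨⟨⟨f, s, congrFun hsf, hfs⟩, hf.continuous, s.continuous⟩, rfl⟩

variable {E F : Type*} [NormedAddCommGroup E] [NormedSpace ℝ E] [NormedAddCommGroup F]
  [NormedSpace ℝ F]

/-- A smooth diffeomorphism between normed spaces which is Lipschitz in both directions. -/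
structure IsBilipschitzDiffeo (e : E ≃ F) : Prop where
  contDiff : ContDiff ℝ ∞ e
  contDiff_symm : ContDiff ℝ ∞ e.symm
  lipschitz : ∃ K, LipschitzWith K e
  lipschitz_symm : ∃ K, LipschitzWith K e.symm

theorem exists_approximatesLinearOn_ball {f : E → F} {f' : E → E →L[ℝ] F}
    (hf : ∀ x, HasFDerivAt f (f' x) x) (hf' : UniformContinuous f') {c : ℝ≥0} (hc : 0 < c) :
    ∃ r > 0, ∀ x, ApproximatesLinearOn f (f' x) (ball x r) c := by
  obtain ⟨r, hr, hfr⟩ := Metric.uniformContinuous_iff_le.1 hf' c hc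
  refine ⟨r, hr, fun x u hu v hv => ?_⟩
  refine (convex_ball x r).norm_image_sub_le_of_norm_hasFDerivWithin_le'
    (fun z _ => (hf z).hasFDerivWithinAt) (fun z hz => ?_) hv hu
  rw [← dist_eq_norm]
  exact hfr (mem_ball.1 hz).le

theorem isCoveringMap_of_uniformContinuous_fderiv [CompleteSpace E] {f : E → F}
    {f' : E → E ≃L[ℝ] F} {K : ℝ≥0} (hf : ∀ x, HasFDerivAt f (f' x : E →L[ℝ] F) x)
    (hf' : UniformContinuous fun x => (f' x : E →L[ℝ] F))
    (hK : ∀ x, ‖((f' x).symm : F →L[ℝ] E)‖₊ ≤ K) :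
    IsCoveringMap f := by
  set c : ℝ≥0 := (2 * (K + 1))⁻¹ with hc
  have hcK (x : E) (hx : 0 < ‖((f' x).symm : F →L[ℝ] E)‖₊) :
      c < ‖((f' x).symm : F →L[ℝ] E)‖₊⁻¹ := by
    refine inv_strictAnti₀ hx ((hK x).trans_lt ?_)
    rw [two_mul, add_assoc]
    exact lt_add_of_pos_right K (by positivity)
  obtain ⟨r, hr, happrox⟩ := exists_approximatesLinearOn_ball hf hf' (c := c) (by positivity)
  refine isCoveringMap_of_surjOn_ball (r := r / 2) (ρ := c * (r / 4)) (by positivity)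
    (continuous_iff_continuousAt.2 fun x => (hf x).continuousAt)
    (isOpenMap_of_hasStrictFDerivAt_equiv fun x =>
      hasStrictFDerivAt_of_hasFDerivAt_of_continuousAt (.of_forall hf) hf'.continuous.continuousAt)
    (fun x => ?_) fun x => ?_
  · rw [mul_div_cancel₀ _ two_ne_zero]
    exact (happrox x).injOn ((f' x).subsingleton_or_nnnorm_symm_pos.imp_right (hcK x))
  · let inv : (f' x : E →L[ℝ] F).NonlinearRightInverse :=
      { toFun := (f' x).symm
        nnnorm := K + 1
        bound' := fun y => ((f' x).symm : F →L[ℝ] E).le_of_opNorm_le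
          ((hK x).trans (le_add_of_nonneg_right zero_le_one)) y
        right_inv' := (f' x).apply_symm_apply }
    have hsurj := (happrox x).surjOn_closedBall_of_nonlinearRightInverse inv (b := x)
      (ε := r / 4) (by positivity) (closedBall_subset_ball (by linarith))
    have hradius : ((inv.nnnorm : ℝ)⁻¹ - c) * (r / 4) = c * (r / 4) := by
      simp only [inv, hc]
      push_cast
      field_simp
      norm_num
    rw [hradius] at hsurj
    exact hsurj.mono (closedBall_subset_ball (by linarith)) ball_subset_closedBall

theorem exists_isBilipschitzDiffeo_of_hasFDerivAt [CompleteSpace E] {f : E → F} {f' : E → E ≃L[ℝ] F}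
    {K L : ℝ≥0} (hf : ∀ x, HasFDerivAt f (f' x : E →L[ℝ] F) x) (hsmooth : ContDiff ℝ ∞ f)
    (hf' : UniformContinuous fun x => (f' x : E →L[ℝ] F)) (hL : ∀ x, ‖(f' x : E →L[ℝ] F)‖₊ ≤ L)
    (hK : ∀ x, ‖((f' x).symm : F →L[ℝ] E)‖₊ ≤ K) :
    ∃ e : E ≃ F, ⇑e = f ∧ IsBilipschitzDiffeo e := by
  obtain ⟨e, rfl⟩ :=
    exists_homeomorph_of_isCoveringMap (isCoveringMap_of_uniformContinuous_fderiv hf hf' hK)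
  have hsymm (y : F) : HasFDerivAt e.symm ((f' (e.symm y)).symm : F →L[ℝ] E) y :=
    HasFDerivAt.of_local_left_inverse e.symm.continuous.continuousAt (hf _)
      (.of_forall e.apply_symm_apply)
  exact ⟨e, rfl, hsmooth, e.contDiff_symm hf hsmooth,
    ⟨L, lipschitzWith_of_nnnorm_fderiv_le (𝕜 := ℝ) (fun x => (hf x).differentiableAt)
      fun x => (hf x).fderiv ▸ hL x⟩,
    ⟨K, lipschitzWith_of_nnnorm_fderiv_le (𝕜 := ℝ) (fun y => (hsymm y).differentiableAt)
      fun y => (hsymm y).fderiv ▸ hK _⟩⟩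

theorem exists_norm_inverse_le_of_le_abs_det [FiniteDimensional ℝ E] (C : ℝ) {δ : ℝ}
    (hδ : 0 < δ) :
    ∃ K, ∀ A : E →L[ℝ] E, ‖A‖ ≤ C → δ ≤ |A.det| → ‖Ring.inverse A‖ ≤ K := by
  have hcompact : IsCompact (closedBall (0 : E →L[ℝ] E) C ∩ {A | δ ≤ |A.det|}) :=
    (isCompact_closedBall 0 C).inter_right
      (isClosed_le continuous_const ContinuousLinearMap.continuous_det.abs)
  obtain ⟨K, hK⟩ := hcompact.exists_bound_of_continuousOn (f := Ring.inverse)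
    fun A hA => by
      have hdet : A.det ≠ 0 := abs_pos.1 (hδ.trans_le hA.2)
      obtain ⟨u, rfl⟩ : IsUnit A :=
        ⟨(A.toContinuousLinearEquivOfDetNeZero hdet).toUnit,
          A.coe_toContinuousLinearEquivOfDetNeZero hdet⟩
      exact (NormedRing.inverse_continuousAt u).continuousWithinAt
  exact ⟨K, fun A hA hdet => hK A ⟨mem_closedBall_zero_iff.2 hA, hdet⟩⟩

/-- A smooth function whose derivatives of each order at least `n` are bounded. -/
structure BoundedDerivsFrom (n : ℕ) (f : E → F) : Prop where
  contDiff : ContDiff ℝ ∞ f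
  bounded : ∀ k, n ≤ k → ∃ C, ∀ x, ‖iteratedFDeriv ℝ k f x‖ ≤ C

namespace BoundedDerivsFrom

variable {G : Type*} [NormedAddCommGroup G] [NormedSpace ℝ G] {n : ℕ} {f g : E → F}

theorem mono {m : ℕ} (hf : BoundedDerivsFrom m f) (hmn : m ≤ n) : BoundedDerivsFrom n f :=
  ⟨hf.contDiff, fun k hk => hf.bounded k (hmn.trans hk)⟩

theorem fderiv_right (hf : BoundedDerivsFrom (n + 1) f) : BoundedDerivsFrom n (fderiv ℝ f) where
  contDiff := hf.contDiff.fderiv_right (by simp)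
  bounded k hk := by
    simpa only [norm_iteratedFDeriv_fderiv] using hf.bounded (k + 1) (by lia)

theorem add (hf : BoundedDerivsFrom n f) (hg : BoundedDerivsFrom n g) :
    BoundedDerivsFrom n (f + g) where
  contDiff := hf.contDiff.add hg.contDiff
  bounded k hk := by
    obtain ⟨C, hC⟩ := hf.bounded k hk
    obtain ⟨C', hC'⟩ := hg.bounded k hk
    refine ⟨C + C', fun x => ?_⟩
    rw [iteratedFDeriv_add_apply (contDiff_infty.1 hf.contDiff k).contDiffAt
      (contDiff_infty.1 hg.contDiff k).contDiffAt]
    exact norm_add_le_of_le (hC x) (hC' x)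

theorem clm_comp (L : F →L[ℝ] G) (hf : BoundedDerivsFrom n f) : BoundedDerivsFrom n (L ∘ f) where
  contDiff := L.contDiff.comp hf.contDiff
  bounded k hk := by
    obtain ⟨C, hC⟩ := hf.bounded k hk
    exact ⟨‖L‖ * C, fun x => (L.norm_iteratedFDeriv_comp_left
      (contDiff_infty.1 hf.contDiff k).contDiffAt le_rfl).trans (by gcongr; exact hC x)⟩

theorem prodMk {g : E → G} (hf : BoundedDerivsFrom n f) (hg : BoundedDerivsFrom n g) :
    BoundedDerivsFrom n fun x => (f x, g x) := by
  simpa [Function.comp_def, Pi.add_def] using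
    (hf.clm_comp (.inl ℝ F G)).add (hg.clm_comp (.inr ℝ F G))

theorem exists_lipschitzWith (hf : BoundedDerivsFrom 1 f) : ∃ K, LipschitzWith K f := by
  obtain ⟨C, hC⟩ := hf.bounded 1 le_rfl
  refine ⟨C.toNNReal, lipschitzWith_of_nnnorm_fderiv_le (𝕜 := ℝ)
    (hf.contDiff.differentiable (by simp)) fun x => ?_⟩
  rw [← NNReal.coe_le_coe, coe_nnnorm, ← norm_iteratedFDeriv_one]
  exact (hC x).trans (Real.le_coe_toNNReal C)

theorem of_clm (L : E →L[ℝ] F) : BoundedDerivsFrom 1 L where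
  contDiff := L.contDiff
  bounded k hk := by
    obtain ⟨k, rfl⟩ := Nat.exists_eq_add_of_le' hk
    have hfderiv : fderiv ℝ L = fun _ => L := funext fun _ => L.fderiv
    refine ⟨‖L‖, fun x => ?_⟩
    rw [← norm_iteratedFDeriv_fderiv, hfderiv]
    obtain rfl | hk' := eq_or_ne k 0
    · rw [norm_iteratedFDeriv_zero]
    · simp [iteratedFDeriv_const_of_ne hk']

end BoundedDerivsFrom

theorem BoundedDerivsFrom.exists_isBilipschitzDiffeo [FiniteDimensional ℝ E] {f : E → E} {δ : ℝ}
    (hf : BoundedDerivsFrom 1 f) (hδ : 0 < δ) (hdet : ∀ x, δ ≤ |(fderiv ℝ f x).det|) :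
    ∃ e : E ≃ E, ⇑e = f ∧ IsBilipschitzDiffeo e := by
  have := FiniteDimensional.complete ℝ E
  obtain ⟨L, hL⟩ := hf.exists_lipschitzWith
  obtain ⟨M, hM⟩ := ((hf.mono one_le_two).fderiv_right).exists_lipschitzWith
  have hL' (x : E) : ‖fderiv ℝ f x‖₊ ≤ L := norm_fderiv_le_of_lipschitz ℝ hL
  obtain ⟨K, hK⟩ := exists_norm_inverse_le_of_le_abs_det (E := E) L hδ
  let f' (x : E) : E ≃L[ℝ] E :=
    (fderiv ℝ f x).toContinuousLinearEquivOfDetNeZero (abs_pos.1 (hδ.trans_le (hdet x)))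
  have hf' (x : E) : (f' x : E →L[ℝ] E) = fderiv ℝ f x :=
    ContinuousLinearMap.coe_toContinuousLinearEquivOfDetNeZero _ _
  refine exists_isBilipschitzDiffeo_of_hasFDerivAt (f' := f') (L := L) (K := K.toNNReal)
    (fun x => (hf' x).symm ▸ (hf.contDiff.differentiable (by simp) x).hasFDerivAt) hf.contDiff
    (by simpa only [hf'] using hM.uniformContinuous) (fun x => (hf' x).symm ▸ hL' x) fun x => ?_
  have hinv : ((f' x).symm : E →L[ℝ] E) = Ring.inverse (fderiv ℝ f x) := by
    rw [← hf' x, ContinuousLinearMap.ringInverse_equiv]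
    exact (ContinuousLinearMap.inverse_equiv _).symm
  rw [hinv, ← NNReal.coe_le_coe, coe_nnnorm]
  exact (hK _ (hL' x) (hdet x)).trans (le_max_left _ _)

namespace IsBilipschitzDiffeo

variable {G : Type*} [NormedAddCommGroup G] [NormedSpace ℝ G]

variable {e : E ≃ F} {e' : F ≃ G}

theorem symm (he : IsBilipschitzDiffeo e) : IsBilipschitzDiffeo e.symm :=
  ⟨he.contDiff_symm, he.contDiff, he.lipschitz_symm, he.lipschitz⟩

theorem trans (he : IsBilipschitzDiffeo e) (he' : IsBilipschitzDiffeo e') :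
    IsBilipschitzDiffeo (e.trans e') :=
  ⟨he'.contDiff.comp he.contDiff, he.contDiff_symm.comp he'.contDiff_symm,
    he'.lipschitz.elim fun K' hK' => he.lipschitz.elim fun K hK => ⟨K' * K, hK'.comp hK⟩,
    he.lipschitz_symm.elim fun K hK =>
      he'.lipschitz_symm.elim fun K' hK' => ⟨K * K', hK.comp hK'⟩⟩

end IsBilipschitzDiffeo

end GlobalInverse

section BlockTriangular

variable {R M M' : Type*} [CommRing R] [AddCommGroup M] [AddCommGroup M'] [Module R M] [Module R M']
  [Module.Free R M] [Module.Free R M'] [Module.Finite R M] [Module.Finite R M']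

theorem det_prod_snd (T : M × M' →ₗ[R] M) :
    (T.prod (.snd R M M')).det = (T ∘ₗ .inl R M M').det := by
  classical
  set b := Module.Free.chooseBasis R M
  set b' := Module.Free.chooseBasis R M'
  have hblocks : LinearMap.toMatrix (b.prod b') (b.prod b') (T.prod (.snd R M M')) =
      .fromBlocks (LinearMap.toMatrix b b (T ∘ₗ .inl R M M'))
        (LinearMap.toMatrix b' b (T ∘ₗ .inr R M M')) 0 1 := by
    ext (i | i) (j | j) <;>
      simp [LinearMap.toMatrix_apply, Matrix.one_apply, Finsupp.single_apply, eq_comm]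
  rw [← LinearMap.det_toMatrix (b.prod b'), hblocks, Matrix.det_fromBlocks_zero₂₁, Matrix.det_one,
    mul_one, LinearMap.det_toMatrix]

theorem det_fst_prod (T : M × M' →ₗ[R] M') :
    ((LinearMap.fst R M M').prod T).det = (T ∘ₗ .inr R M M').det := by
  classical
  set b := Module.Free.chooseBasis R M
  set b' := Module.Free.chooseBasis R M'
  have hblocks : LinearMap.toMatrix (b.prod b') (b.prod b') ((LinearMap.fst R M M').prod T) =
      .fromBlocks 1 0 (LinearMap.toMatrix b b' (T ∘ₗ .inl R M M'))
        (LinearMap.toMatrix b' b' (T ∘ₗ .inr R M M')) := by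
    ext (i | i) (j | j) <;>
      simp [LinearMap.toMatrix_apply, Matrix.one_apply, Finsupp.single_apply, eq_comm]
  rw [← LinearMap.det_toMatrix (b.prod b'), hblocks, Matrix.det_fromBlocks_zero₁₂, Matrix.det_one,
    one_mul, LinearMap.det_toMatrix]

end BlockTriangular

section RieszComp

variable {V F : Type*} [NormedAddCommGroup V] [NormedSpace ℝ V] [NormedAddCommGroup F]
  [InnerProductSpace ℝ F] [CompleteSpace F]

/-- The Riesz representative of `ℓ ∘ L`, as a function of the linear form `ℓ`: for `L` the inclusion
of a factor of a product, it turns derivatives into partial gradients. -/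
noncomputable def rieszComp (L : F →L[ℝ] V) : (V →L[ℝ] ℝ) →L[ℝ] F :=
  LinearMap.mkContinuous
    { toFun := fun ℓ => (InnerProductSpace.toDual ℝ F).symm (ℓ.comp L)
      map_add' := fun ℓ ℓ' => by rw [ContinuousLinearMap.add_comp, map_add]
      map_smul' := fun c ℓ => by simp [ContinuousLinearMap.smul_comp] }
    ‖L‖ fun ℓ => by
      rw [mul_comm]
      exact ((InnerProductSpace.toDual ℝ F).symm.norm_map _).trans_le (ℓ.opNorm_comp_le L)

theorem inner_rieszComp_left (L : F →L[ℝ] V) (ℓ : V →L[ℝ] ℝ) (v : F) :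
    inner ℝ (rieszComp L ℓ) v = ℓ (L v) :=
  InnerProductSpace.toDual_symm_apply (y := ℓ.comp L)

theorem inner_rieszComp_right (L : F →L[ℝ] V) (ℓ : V →L[ℝ] ℝ) (v : F) :
    inner ℝ v (rieszComp L ℓ) = ℓ (L v) := by
  rw [real_inner_comm, inner_rieszComp_left]

end RieszComp

section CanonicalTransformation

variable {d : ℕ} {Φ : Phase d → ℝ}

theorem gradX_eq_rieszComp (hΦ : Differentiable ℝ Φ) (x η : Eu d) :
    gradX Φ x η = rieszComp (.inl ℝ (Eu d) (Eu d)) (fderiv ℝ Φ (x, η)) :=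
  congrArg (InnerProductSpace.toDual ℝ (Eu d)).symm
    ((hΦ (x, η)).hasFDerivAt.comp x (hasFDerivAt_prodMk_left x η)).fderiv

theorem gradEta_eq_rieszComp (hΦ : Differentiable ℝ Φ) (x η : Eu d) :
    gradEta Φ x η = rieszComp (.inr ℝ (Eu d) (Eu d)) (fderiv ℝ Φ (x, η)) :=
  congrArg (InnerProductSpace.toDual ℝ (Eu d)).symm
    ((hΦ (x, η)).hasFDerivAt.comp η (hasFDerivAt_prodMk_right x η)).fderiv

/-- The second derivative of `Φ` as a bilinear form. -/
noncomputable abbrev hess (Φ : Phase d → ℝ) (z : Phase d) : Phase d →L[ℝ] Phase d →L[ℝ] ℝ :=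
  fderiv ℝ (fderiv ℝ Φ) z

/-- The map `(x, η) ↦ (∇_η Φ (x, η), η)` reading off the source of the canonical transformation. -/
noncomputable def etaMap (Φ : Phase d → ℝ) (z : Phase d) : Phase d :=
  (gradEta Φ z.1 z.2, z.2)

/-- The map `(x, η) ↦ (x, ∇_x Φ (x, η))` reading off the target of the canonical transformation. -/
noncomputable def xMap (Φ : Phase d → ℝ) (z : Phase d) : Phase d :=
  (z.1, gradX Φ z.1 z.2)

namespace IsPhase

theorem boundedDerivsFrom (hΦ : IsPhase Φ) : BoundedDerivsFrom 2 Φ :=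
  ⟨hΦ.smooth, hΦ.bounded⟩

theorem differentiable (hΦ : IsPhase Φ) : Differentiable ℝ Φ :=
  hΦ.smooth.differentiable (by simp)

theorem hasFDerivAt_fderiv (hΦ : IsPhase Φ) (z : Phase d) :
    HasFDerivAt (fderiv ℝ Φ) (hess Φ z) z :=
  (hΦ.boundedDerivsFrom.fderiv_right.contDiff.differentiable (by simp) z).hasFDerivAt

theorem hess_comm (hΦ : IsPhase Φ) (z u v : Phase d) : hess Φ z u v = hess Φ z v u :=
  ((contDiff_infty.1 hΦ.smooth 2).contDiffAt.isSymmSndFDerivAt (by simp)).eq u v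

theorem mixedHessian_apply (hΦ : IsPhase Φ) (z : Phase d) (i j : Fin d) :
    mixedHessian Φ z i j = hess Φ z (stdVec i, 0) (0, stdVec j) := by
  rw [mixedHessian, Matrix.of_apply,
    ((hΦ.hasFDerivAt_fderiv z).clm_apply (hasFDerivAt_const _ z)).fderiv]
  simp [phaseVec]

theorem etaMap_eq (hΦ : IsPhase Φ) :
    etaMap Φ = fun z => (rieszComp (.inr ℝ (Eu d) (Eu d)) (fderiv ℝ Φ z), z.2) :=
  funext fun z => congrArg (·, z.2) (gradEta_eq_rieszComp hΦ.differentiable z.1 z.2)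

theorem xMap_eq (hΦ : IsPhase Φ) :
    xMap Φ = fun z => (z.1, rieszComp (.inl ℝ (Eu d) (Eu d)) (fderiv ℝ Φ z)) :=
  funext fun z => congrArg (z.1, ·) (gradX_eq_rieszComp hΦ.differentiable z.1 z.2)

theorem boundedDerivsFrom_etaMap (hΦ : IsPhase Φ) : BoundedDerivsFrom 1 (etaMap Φ) :=
  hΦ.etaMap_eq ▸ (hΦ.boundedDerivsFrom.fderiv_right.clm_comp _).prodMk
    (.of_clm (.snd ℝ (Eu d) (Eu d)))

theorem boundedDerivsFrom_xMap (hΦ : IsPhase Φ) : BoundedDerivsFrom 1 (xMap Φ) :=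
  hΦ.xMap_eq ▸ BoundedDerivsFrom.prodMk (.of_clm (.fst ℝ (Eu d) (Eu d)))
    (hΦ.boundedDerivsFrom.fderiv_right.clm_comp _)

theorem fderiv_etaMap (hΦ : IsPhase Φ) (z : Phase d) :
    fderiv ℝ (etaMap Φ) z =
      ((rieszComp (.inr ℝ (Eu d) (Eu d))).comp (hess Φ z)).prod (.snd ℝ (Eu d) (Eu d)) := by
  rw [hΦ.etaMap_eq]
  exact (((rieszComp _).hasFDerivAt.comp z (hΦ.hasFDerivAt_fderiv z)).prodMk hasFDerivAt_snd).fderiv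

theorem fderiv_xMap (hΦ : IsPhase Φ) (z : Phase d) :
    fderiv ℝ (xMap Φ) z = (ContinuousLinearMap.fst ℝ (Eu d) (Eu d)).prod
      ((rieszComp (.inl ℝ (Eu d) (Eu d))).comp (hess Φ z)) := by
  rw [hΦ.xMap_eq]
  exact (hasFDerivAt_fst.prodMk ((rieszComp _).hasFDerivAt.comp z (hΦ.hasFDerivAt_fderiv z))).fderiv

theorem det_fderiv_etaMap (hΦ : IsPhase Φ) (z : Phase d) :
    (fderiv ℝ (etaMap Φ) z).det = (mixedHessian Φ z).det := by
  set b := (EuclideanSpace.basisFun (Fin d) ℝ).toBasis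
  rw [hΦ.fderiv_etaMap, ContinuousLinearMap.det, ContinuousLinearMap.coe_prod,
    ContinuousLinearMap.coe_snd, det_prod_snd, ← LinearMap.det_toMatrix b, ← Matrix.det_transpose]
  congr 1
  ext i j
  rw [hΦ.mixedHessian_apply,
    ← ContinuousLinearMap.inr_apply (R := ℝ), ← inner_rieszComp_left]
  simp [b, LinearMap.toMatrix_apply, stdVec, EuclideanSpace.inner_single_right]

theorem det_fderiv_xMap (hΦ : IsPhase Φ) (z : Phase d) :
    (fderiv ℝ (xMap Φ) z).det = (mixedHessian Φ z).det := by
  set b := (EuclideanSpace.basisFun (Fin d) ℝ).toBasis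
  rw [hΦ.fderiv_xMap, ContinuousLinearMap.det, ContinuousLinearMap.coe_prod,
    ContinuousLinearMap.coe_fst, det_fst_prod, ← LinearMap.det_toMatrix b]
  congr 1
  ext i j
  rw [hΦ.mixedHessian_apply, hΦ.hess_comm,
    ← ContinuousLinearMap.inl_apply (R := ℝ), ← inner_rieszComp_left]
  simp [b, LinearMap.toMatrix_apply, stdVec, EuclideanSpace.inner_single_right]

theorem symplecticForm_fderiv_xMap (hΦ : IsPhase Φ) (z u v : Phase d) :
    symplecticForm (fderiv ℝ (xMap Φ) z u) (fderiv ℝ (xMap Φ) z v) =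
      symplecticForm (fderiv ℝ (etaMap Φ) z u) (fderiv ℝ (etaMap Φ) z v) := by
  have hsplit (p q : Phase d) : hess Φ z p q = hess Φ z p (q.1, 0) + hess Φ z p (0, q.2) := by
    rw [← map_add, Prod.fst_add_snd]
  have hsymm := hΦ.hess_comm z u v
  rw [hsplit u v, hsplit v u] at hsymm
  simp only [symplecticForm, hΦ.fderiv_xMap, hΦ.fderiv_etaMap, ContinuousLinearMap.prod_apply,
    ContinuousLinearMap.comp_apply, ContinuousLinearMap.coe_fst', ContinuousLinearMap.coe_snd',
    inner_rieszComp_left, inner_rieszComp_right, ContinuousLinearMap.inl_apply,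
    ContinuousLinearMap.inr_apply]
  linarith

theorem symplecticForm_fderiv_xMap_comp (hΦ : IsPhase Φ) {s : Phase d → Phase d}
    (hs : Differentiable ℝ s) (hinv : Function.RightInverse s (etaMap Φ)) (p u v : Phase d) :
    symplecticForm (fderiv ℝ (xMap Φ ∘ s) p u) (fderiv ℝ (xMap Φ ∘ s) p v) =
      symplecticForm u v := by
  have hη := hΦ.boundedDerivsFrom_etaMap.contDiff.differentiable (by simp) (s p)
  have hx := hΦ.boundedDerivsFrom_xMap.contDiff.differentiable (by simp) (s p)
  have hid (w : Phase d) : fderiv ℝ (etaMap Φ) (s p) (fderiv ℝ s p w) = w := by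
    rw [← ContinuousLinearMap.comp_apply, ← fderiv_comp p hη (hs p), hinv.comp_eq_id, fderiv_id,
      ContinuousLinearMap.id_apply]
  simp only [fderiv_comp p hx (hs p), ContinuousLinearMap.comp_apply,
    hΦ.symplecticForm_fderiv_xMap, hid]

end IsPhase

theorem isGeneratedBy_xMap_comp_symm {e : Phase d ≃ Phase d} (he : ⇑e = etaMap Φ) :
    IsGeneratedBy Φ (xMap Φ ∘ e.symm) := by
  intro y η x ξ
  obtain ⟨z, hz⟩ := e.surjective (y, η)
  rw [← hz, Function.comp_apply, e.symm_apply_apply]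
  rw [he] at hz
  simp only [etaMap, Prod.mk.injEq] at hz
  obtain ⟨rfl, rfl⟩ := hz
  rw [xMap, Prod.mk.injEq]
  constructor
  · rintro ⟨rfl, rfl⟩
    exact ⟨rfl, rfl⟩
  · rintro ⟨hy, rfl⟩
    have hz : e z = e (x, z.2) := by
      rw [he]
      exact Prod.ext hy rfl
    rw [e.injective hz]
    exact ⟨rfl, rfl⟩

theorem IsPhase.exists_canonicalTransformation (hΦ : IsPhase Φ) :
    ∃ χ : Phase d ≃ Phase d, IsCanonicalTransformation χ ∧ IsGeneratedBy Φ χ := by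
  obtain ⟨δ, hδ, hdet⟩ := hΦ.nondegenerate
  obtain ⟨e, he, hediff⟩ := hΦ.boundedDerivsFrom_etaMap.exists_isBilipschitzDiffeo hδ fun z =>
    (hdet z).trans_eq (congrArg abs (hΦ.det_fderiv_etaMap z).symm)
  obtain ⟨e', he', hediff'⟩ := hΦ.boundedDerivsFrom_xMap.exists_isBilipschitzDiffeo hδ fun z =>
    (hdet z).trans_eq (congrArg abs (hΦ.det_fderiv_xMap z).symm)
  have hχ := hediff.symm.trans hediff'
  have hχ_eq : ⇑(e.symm.trans e') = xMap Φ ∘ e.symm := by rw [Equiv.coe_trans, he']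
  refine ⟨e.symm.trans e', ⟨hχ.contDiff, hχ.contDiff_symm, hχ.lipschitz, hχ.lipschitz_symm, ?_⟩, ?_⟩
  · rw [hχ_eq]
    exact hΦ.symplecticForm_fderiv_xMap_comp (hediff.contDiff_symm.differentiable (by simp))
      (he ▸ e.right_inv)
  · exact hχ_eq ▸ isGeneratedBy_xMap_comp_symm he

theorem IsGeneratedBy.norm_sub_le {χ : Phase d → Phase d} {K : NNReal} (hχ : IsGeneratedBy Φ χ)
    (hK : LipschitzWith K χ) (m n m' n' : Eu d) :
    ‖χ (m, n) - (m', n')‖ ≤ K * ‖gradEta Φ m' n - m‖ + ‖gradX Φ m' n - n'‖ := by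
  have hgen : χ (gradEta Φ m' n, n) = (m', gradX Φ m' n) := (hχ _ _ _ _).2 ⟨rfl, rfl⟩
  calc ‖χ (m, n) - (m', n')‖
      ≤ ‖χ (m, n) - χ (gradEta Φ m' n, n)‖ + ‖χ (gradEta Φ m' n, n) - (m', n')‖ :=
        norm_sub_le_norm_sub_add_norm_sub _ _ _
    _ ≤ K * ‖gradEta Φ m' n - m‖ + ‖gradX Φ m' n - n'‖ := by
        refine add_le_add ?_ ?_
        · simpa [Prod.norm_def, norm_sub_rev m] using hK.norm_sub_le (m, n) (gradEta Φ m' n, n)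
        · simp [hgen, Prod.norm_def]

end CanonicalTransformation

section WeakDerivative

open Filter Topology

theorem tendsto_integral_mul_of_dominated {α 𝕜 : Type*} [MeasurableSpace α] {μ : Measure α}
    [RCLike 𝕜] {σ f : α → 𝕜} (hσ : MemLp σ ⊤ μ) {F : ℕ → α → 𝕜} {G : α → ℝ}
    (hF : ∀ n, AEStronglyMeasurable (F n) μ) (hG : Integrable G μ) (hFG : ∀ n x, ‖F n x‖ ≤ G x)
    (hlim : ∀ x, Tendsto (F · x) atTop (𝓝 (f x))) :
    Tendsto (fun n => ∫ x, σ x * F n x ∂μ) atTop (𝓝 (∫ x, σ x * f x ∂μ)) := by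
  refine tendsto_integral_of_dominated_convergence (fun x => lpNorm σ ⊤ μ * G x)
    (fun n => hσ.1.mul (hF n)) (hG.const_mul _) (fun n => ?_)
    (.of_forall fun x => (hlim x).const_mul _)
  filter_upwards [ae_le_lpNorm_exponent_top hσ] with x hx
  rw [norm_mul]
  exact mul_le_mul hx (hFG n x) (norm_nonneg _) lpNorm_nonneg

variable {E : Type*} [NormedAddCommGroup E] [NormedSpace ℝ E]

/-- Smooth compactly supported functions bounded by one, with uniformly bounded derivatives, which
exhaust the space: near each point, all but finitely many of them are identically one. -/
structure IsCutoffSeq (ψ : ℕ → E → ℂ) : Prop where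
  contDiff : ∀ n, ContDiff ℝ ∞ (ψ n)
  hasCompactSupport : ∀ n, HasCompactSupport (ψ n)
  norm_le_one : ∀ n z, ‖ψ n z‖ ≤ 1
  norm_fderiv_le : ∃ B, ∀ n z, ‖fderiv ℝ (ψ n) z‖ ≤ B
  eventuallyEq_one : ∀ z, ∀ᶠ n in atTop, ψ n =ᶠ[𝓝 z] 1

theorem exists_isCutoffSeq [FiniteDimensional ℝ E] : ∃ ψ : ℕ → E → ℂ, IsCutoffSeq ψ := by
  let f : ContDiffBump (0 : E) := ⟨1, 2, one_pos, one_lt_two⟩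
  let F : E → ℂ := fun z => (f z : ℂ)
  have hF : ContDiff ℝ ∞ F := Complex.ofRealCLM.contDiff.comp f.contDiff
  have hFc : HasCompactSupport F := f.hasCompactSupport.comp_left Complex.ofReal_zero
  obtain ⟨B, hB⟩ := (hF.continuous_fderiv (by simp)).bounded_above_of_compact_support
    (hFc.fderiv ℝ)
  have hpos (n : ℕ) : (0 : ℝ) < ((n : ℝ) + 1)⁻¹ := by positivity
  refine ⟨fun n z => F (((n : ℝ) + 1)⁻¹ • z), fun n => hF.comp (contDiff_const_smul _),
    fun n => hFc.comp_smul (hpos n).ne', fun n z => ?_, ⟨B, fun n z => ?_⟩, fun z => ?_⟩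
  · simp only [F, Complex.norm_real, Real.norm_of_nonneg f.nonneg, f.le_one]
  · rw [fderiv_comp_smul, norm_smul, Real.norm_of_nonneg (hpos n).le]
    exact (mul_le_of_le_one_left (norm_nonneg _) (inv_le_one_of_one_le₀ (by simp))).trans (hB _)
  · filter_upwards [eventually_gt_atTop ⌈‖z‖⌉₊] with n hn
    have hzn : ‖z‖ < (n : ℝ) + 1 :=
      ((Nat.le_ceil _).trans_lt (Nat.cast_lt.2 hn)).trans (lt_add_one _)
    filter_upwards [continuous_norm.continuousAt.eventually_lt continuousAt_const hzn] with y hy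
    have hmem : ((n : ℝ) + 1)⁻¹ • y ∈ Metric.closedBall (0 : E) 1 := by
      rw [mem_closedBall_zero_iff, norm_smul, Real.norm_of_nonneg (hpos n).le,
        inv_mul_le_iff₀ (by positivity), mul_one]
      exact hy.le
    simp only [F, f.one_of_mem_closedBall hmem, Complex.ofReal_one, Pi.one_apply]

namespace IsCutoffSeq

variable {ψ : ℕ → E → ℂ} {φ : E → ℂ}

theorem eventually_mul_eventuallyEq (hψ : IsCutoffSeq ψ) (φ : E → ℂ) (z : E) :
    ∀ᶠ n in atTop, (fun y => ψ n y * φ y) =ᶠ[𝓝 z] φ := by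
  filter_upwards [hψ.eventuallyEq_one z] with n hn
  filter_upwards [hn] with y hy
  rw [hy, Pi.one_apply, one_mul]

theorem exists_norm_fderiv_mul_apply_le (hψ : IsCutoffSeq ψ) (hφ : Differentiable ℝ φ) (v : E) :
    ∃ B, ∀ n z, ‖fderiv ℝ (fun y => ψ n y * φ y) z v‖ ≤ ‖fderiv ℝ φ z v‖ + B * ‖φ z‖ := by
  obtain ⟨B, hB⟩ := hψ.norm_fderiv_le
  refine ⟨B * ‖v‖, fun n z => ?_⟩
  have hprod : fderiv ℝ (fun y => ψ n y * φ y) z v =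
      ψ n z * fderiv ℝ φ z v + φ z * fderiv ℝ (ψ n) z v := by
    rw [fderiv_fun_mul ((hψ.contDiff n).differentiable (by simp) z) (hφ z)]
    rfl
  rw [hprod]
  refine (norm_add_le _ _).trans (add_le_add ?_ ?_)
  · rw [norm_mul]
    exact mul_le_of_le_one_left (norm_nonneg _) (hψ.norm_le_one n z)
  · rw [norm_mul, mul_comm]
    gcongr
    exact (fderiv ℝ (ψ n) z).le_of_opNorm_le (hB n z) v

end IsCutoffSeq

variable [MeasurableSpace E]

/-- `τ` is the weak derivative of `σ` in the direction `v`. -/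
def IsWeakDeriv (μ : Measure E) (v : E) (σ τ : E → ℂ) : Prop :=
  ∀ φ : E → ℂ, ContDiff ℝ ∞ φ → HasCompactSupport φ →
    ∫ z, σ z * fderiv ℝ φ z v ∂μ = -∫ z, τ z * φ z ∂μ

theorem IsWeakDeriv.integral_mul_fderiv [FiniteDimensional ℝ E] [BorelSpace E] {μ : Measure E}
    {v : E} {σ τ φ : E → ℂ} (h : IsWeakDeriv μ v σ τ) (hσ : MemLp σ ⊤ μ) (hτ : MemLp τ ⊤ μ)
    (hφ : ContDiff ℝ ∞ φ) (hφi : Integrable φ μ) (hφi' : Integrable (fun z => fderiv ℝ φ z v) μ) :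
    ∫ z, σ z * fderiv ℝ φ z v ∂μ = -∫ z, τ z * φ z ∂μ := by
  obtain ⟨ψ, hψ⟩ := exists_isCutoffSeq (E := E)
  obtain ⟨B, hB⟩ := hψ.exists_norm_fderiv_mul_apply_le (hφ.differentiable (by simp)) v
  have hsmooth (n : ℕ) : ContDiff ℝ ∞ fun z => ψ n z * φ z := (hψ.contDiff n).mul hφ
  have hleft : Tendsto (fun n => ∫ z, σ z * fderiv ℝ (fun z => ψ n z * φ z) z v ∂μ) atTop
      (𝓝 (∫ z, σ z * fderiv ℝ φ z v ∂μ)) :=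
    tendsto_integral_mul_of_dominated hσ
      (fun n => (((hsmooth n).continuous_fderiv (by simp)).clm_apply
        continuous_const).aestronglyMeasurable)
      (hφi'.norm.add (hφi.norm.const_mul B)) hB fun z =>
        tendsto_const_nhds.congr' <| (hψ.eventually_mul_eventuallyEq φ z).mono fun n hn =>
          DFunLike.congr_fun hn.fderiv_eq.symm v
  have hright : Tendsto (fun n => ∫ z, τ z * (ψ n z * φ z) ∂μ) atTop (𝓝 (∫ z, τ z * φ z ∂μ)) :=
    tendsto_integral_mul_of_dominated hτ (fun n => (hsmooth n).continuous.aestronglyMeasurable)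
      hφi.norm
      (fun n z => (norm_mul _ _).trans_le <|
        mul_le_of_le_one_left (norm_nonneg _) (hψ.norm_le_one n z)) fun z =>
        tendsto_const_nhds.congr' <| (hψ.eventually_mul_eventuallyEq φ z).mono fun n hn =>
          hn.self_of_nhds.symm
  refine tendsto_nhds_unique hleft (hright.neg.congr fun n => ?_)
  exact (h _ (hsmooth n) (hψ.hasCompactSupport n).mul_right).symm

end WeakDerivative

section FourierChar

theorem iteratedDeriv_fourierChar (n : ℕ) :
    iteratedDeriv n (fun t : ℝ => (𝐞 t : ℂ)) =
      fun t => (2 * Real.pi * Complex.I) ^ n * (𝐞 t : ℂ) := by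
  induction n with
  | zero => simp only [iteratedDeriv_zero, pow_zero, one_mul]
  | succ n ih =>
    rw [iteratedDeriv_succ, ih]
    funext t
    rw [((Real.hasDerivAt_fourierChar t).const_mul _).deriv]
    ring

theorem norm_two_pi_I : ‖(2 * Real.pi * Complex.I : ℂ)‖ = 2 * Real.pi := by
  simp [abs_of_pos Real.pi_pos]

theorem one_le_two_pi : 1 ≤ 2 * Real.pi := by
  linarith [Real.pi_gt_three]

theorem norm_iteratedFDeriv_fourierChar (n : ℕ) (t : ℝ) :
    ‖iteratedFDeriv ℝ n (fun t : ℝ => (𝐞 t : ℂ)) t‖ = (2 * Real.pi) ^ n := by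
  rw [norm_iteratedFDeriv_eq_norm_iteratedDeriv, iteratedDeriv_fourierChar, norm_mul,
    Circle.norm_coe, mul_one, norm_pow, norm_two_pi_I]

theorem contDiff_fourierChar : ContDiff ℝ ∞ fun t : ℝ => (𝐞 t : ℂ) := by
  simp only [Real.fourierChar_apply]
  exact ((Complex.ofRealCLM.contDiff.comp (contDiff_const.mul contDiff_id)).mul
    contDiff_const).cexp

theorem conj_fourierChar (t : ℝ) : (starRingEnd ℂ) (𝐞 t : ℂ) = 𝐞 (-t) := by
  rw [AddChar.map_neg_eq_inv, Circle.coe_inv_eq_conj]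

variable {E : Type*} [NormedAddCommGroup E] [NormedSpace ℝ E]

theorem fderiv_mul_fourierChar_apply {a : E → ℂ} {z : E} (ha : DifferentiableAt ℝ a z)
    (L : E →L[ℝ] ℝ) (v : E) :
    fderiv ℝ (fun z => a z * (𝐞 (L z) : ℂ)) z v =
      fderiv ℝ a z v * (𝐞 (L z) : ℂ) + 2 * Real.pi * Complex.I * L v * (a z * (𝐞 (L z) : ℂ)) := by
  have hchar := (Real.hasDerivAt_fourierChar (L z)).hasFDerivAt.comp z L.hasFDerivAt
  refine (DFunLike.congr_fun (ha.hasFDerivAt.mul hchar).fderiv v).trans ?_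
  simp only [Function.comp_apply, add_apply, smul_apply, ContinuousLinearMap.comp_apply,
    ContinuousLinearMap.toSpanSingleton_apply, Complex.real_smul, smul_eq_mul]
  ring

end FourierChar

section IntegrationByParts

variable {E : Type*} [NormedAddCommGroup E] [NormedSpace ℝ E]
  [MeasurableSpace E] [BorelSpace E] {μ : Measure E} {σ τ a : E → ℂ} {v : E}

theorem integrable_mul_fourierChar (ha : Integrable a μ) (L : E →L[ℝ] ℝ) :
    Integrable (fun z => a z * (𝐞 (L z) : ℂ)) μ :=
  ha.mul_bdd (c := 1) (contDiff_fourierChar.continuous.comp L.continuous).aestronglyMeasurable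
    (.of_forall fun _ => (Circle.norm_coe _).le)

variable [FiniteDimensional ℝ E]

theorem IsWeakDeriv.mul_integral_mul_fourierChar (h : IsWeakDeriv μ v σ τ) (hσ : MemLp σ ⊤ μ)
    (hτ : MemLp τ ⊤ μ) (ha : ContDiff ℝ ∞ a) (hai : Integrable a μ)
    (hai' : Integrable (fun z => fderiv ℝ a z v) μ) (L : E →L[ℝ] ℝ) :
    2 * Real.pi * Complex.I * L v * ∫ z, σ z * (a z * (𝐞 (L z) : ℂ)) ∂μ =
      -∫ z, τ z * (a z * (𝐞 (L z) : ℂ)) ∂μ -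
        ∫ z, σ z * (fderiv ℝ a z v * (𝐞 (L z) : ℂ)) ∂μ := by
  have hderiv (z : E) := fderiv_mul_fourierChar_apply (ha.differentiable (by simp) z) L v
  have hi := integrable_mul_fourierChar hai L
  have hi' := integrable_mul_fourierChar hai' L
  have hσi : Integrable (fun z => σ z * (a z * (𝐞 (L z) : ℂ))) μ := hi.mul_of_top_right hσ
  have hσi' : Integrable (fun z => σ z * (fderiv ℝ a z v * (𝐞 (L z) : ℂ))) μ :=
    hi'.mul_of_top_right hσ
  have hsmooth := ha.mul (contDiff_fourierChar.comp L.contDiff)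
  have hparts := h.integral_mul_fderiv hσ hτ hsmooth hi <| by
    simp only [Function.comp_apply, hderiv]
    exact hi'.add (hi.const_mul _)
  simp only [Function.comp_apply, hderiv, mul_add, mul_left_comm (σ _) (_ * _ * _ * _)] at hparts
  rw [integral_add hσi' (hσi.const_mul _), integral_const_mul] at hparts
  linear_combination hparts

theorem IsWeakDeriv.abs_mul_norm_integral_le (h : IsWeakDeriv μ v σ τ) (hσ : MemLp σ ⊤ μ)
    (hτ : MemLp τ ⊤ μ) (ha : ContDiff ℝ ∞ a) (hai : Integrable a μ)
    (hai' : Integrable (fun z => fderiv ℝ a z v) μ) (L : E →L[ℝ] ℝ) :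
    |L v| * ‖∫ z, σ z * (a z * (𝐞 (L z) : ℂ)) ∂μ‖ ≤
      ‖∫ z, τ z * (a z * (𝐞 (L z) : ℂ)) ∂μ‖ +
        ‖∫ z, σ z * (fderiv ℝ a z v * (𝐞 (L z) : ℂ)) ∂μ‖ := by
  set I := ∫ z, σ z * (a z * (𝐞 (L z) : ℂ)) ∂μ
  calc |L v| * ‖I‖ ≤ 2 * Real.pi * (|L v| * ‖I‖) :=
        le_mul_of_one_le_left (by positivity) one_le_two_pi
    _ = ‖2 * Real.pi * Complex.I * L v * I‖ := by
        rw [norm_mul, norm_mul, norm_two_pi_I, Complex.norm_real, Real.norm_eq_abs]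
        ring
    _ ≤ _ := by
        rw [h.mul_integral_mul_fourierChar hσ hτ ha hai hai']
        exact (norm_sub_le _ _).trans_eq (by rw [norm_neg])

end IntegrationByParts

section UniformBounds

variable {ι E F G : Type*} [NormedAddCommGroup E] [NormedSpace ℝ E] [NormedAddCommGroup F]
  [NormedSpace ℝ F] [NormedAddCommGroup G] [NormedSpace ℝ G]

/-- The members of the family `a` are smooth, and their derivatives of order at most `K` are
dominated by a multiple of the weights `w`, uniformly in the family. -/
structure HasUniformBounds (K : ℕ) (w : ι → E → ℝ) (a : ι → E → F) : Prop where
  contDiff : ∀ p, ContDiff ℝ ∞ (a p)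
  bound : ∃ C : ℝ, 0 ≤ C ∧ ∀ k ≤ K, ∀ p z, ‖iteratedFDeriv ℝ k (a p) z‖ ≤ C * w p z

namespace HasUniformBounds

variable {K : ℕ} {w w' : ι → E → ℝ}

theorem of_le {a : ι → E → F} (ha : HasUniformBounds K w a) {K' : ℕ} (hK : K' ≤ K) :
    HasUniformBounds K' w a := by
  obtain ⟨C, hC0, hC⟩ := ha.bound
  exact ⟨ha.contDiff, C, hC0, fun k hk => hC k (hk.trans hK)⟩

theorem mono {a : ι → E → F} (ha : HasUniformBounds K w a) (hw : ∀ p z, w p z ≤ w' p z) :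
    HasUniformBounds K w' a := by
  obtain ⟨C, hC0, hC⟩ := ha.bound
  exact ⟨ha.contDiff, C, hC0, fun k hk p z =>
    (hC k hk p z).trans (mul_le_mul_of_nonneg_left (hw p z) hC0)⟩

theorem mul {A : Type*} [NormedRing A] [NormedAlgebra ℝ A] {a b : ι → E → A}
    (ha : HasUniformBounds K w a) (hb : HasUniformBounds K w' b) (hw : ∀ p z, 0 ≤ w p z)
    (hw' : ∀ p z, 0 ≤ w' p z) :
    HasUniformBounds K (fun p z => w p z * w' p z) (fun p z => a p z * b p z) := by
  obtain ⟨C, hC0, hC⟩ := ha.bound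
  obtain ⟨C', hC0', hC'⟩ := hb.bound
  refine ⟨fun p => (ha.contDiff p).mul (hb.contDiff p), 2 ^ K * (C * C'), by positivity,
    fun k hk p z => ?_⟩
  have hww := mul_nonneg (hw p z) (hw' p z)
  calc ‖iteratedFDeriv ℝ k (fun z => a p z * b p z) z‖
      ≤ ∑ i ∈ Finset.range (k + 1), (k.choose i : ℝ) * ‖iteratedFDeriv ℝ i (a p) z‖ *
          ‖iteratedFDeriv ℝ (k - i) (b p) z‖ :=
        norm_iteratedFDeriv_mul_le (ha.contDiff p) (hb.contDiff p) z (by exact_mod_cast le_top)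
    _ ≤ ∑ i ∈ Finset.range (k + 1), (k.choose i : ℝ) * (C * w p z) * (C' * w' p z) := by
        refine Finset.sum_le_sum fun i hi => ?_
        have hi_le := hC i ((Finset.mem_range_succ_iff.1 hi).trans hk) p z
        have hki_le := hC' (k - i) ((Nat.sub_le _ _).trans hk) p z
        have := (norm_nonneg _).trans hi_le
        gcongr
    _ = 2 ^ k * (C * C') * (w p z * w' p z) := by
        rw [← Finset.sum_mul, ← Finset.sum_mul, ← Nat.cast_sum, Nat.sum_range_choose]
        push_cast
        ring
    _ ≤ 2 ^ K * (C * C') * (w p z * w' p z) := by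
        gcongr
        exact one_le_two

theorem fderiv_apply {a : ι → E → F} (ha : HasUniformBounds (K + 1) w a) (v : E) :
    HasUniformBounds K w (fun p z => fderiv ℝ (a p) z v) := by
  obtain ⟨C, hC0, hC⟩ := ha.bound
  have hsmooth (p : ι) : ContDiff ℝ ∞ (fderiv ℝ (a p)) := (ha.contDiff p).fderiv_right (by simp)
  refine ⟨fun p => (hsmooth p).clm_apply contDiff_const, ‖v‖ * C, by positivity,
    fun k hk p z => ?_⟩
  refine (norm_iteratedFDeriv_clm_apply_const (hsmooth p).contDiffAt
    (by exact_mod_cast le_top)).trans ?_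
  rw [norm_iteratedFDeriv_fderiv, mul_assoc]
  gcongr
  exact hC (k + 1) (Nat.succ_le_succ hk) p z

theorem linearIsometryEquiv_comp {a : ι → E → F} (ha : HasUniformBounds K w a) (e : F ≃ₗᵢ[ℝ] G) :
    HasUniformBounds K w (fun p z => e (a p z)) := by
  obtain ⟨C, hC0, hC⟩ := ha.bound
  refine ⟨fun p => e.contDiff.comp (ha.contDiff p), C, hC0, fun k hk p z => ?_⟩
  exact (e.norm_iteratedFDeriv_comp_left (a p) z k).trans_le (hC k hk p z)

variable [MeasurableSpace E] [BorelSpace E] {μ : Measure E} {W : E → ℝ} {c : ι → E}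
  {a : ι → E → ℂ}

theorem integrable [μ.IsAddRightInvariant] (ha : HasUniformBounds K (fun p z => W (z - c p)) a)
    (hW : Integrable W μ) (p : ι) : Integrable (a p) μ := by
  obtain ⟨C, -, hC⟩ := ha.bound
  refine ((hW.comp_sub_right (c p)).const_mul C).mono'
    (ha.contDiff p).continuous.aestronglyMeasurable (.of_forall fun z => ?_)
  simpa only [norm_iteratedFDeriv_zero] using hC 0 (Nat.zero_le _) p z

theorem exists_norm_integral_le [μ.IsAddRightInvariant]
    (ha : HasUniformBounds K (fun p z => W (z - c p)) a) (hW : Integrable W μ) {σ : E → ℂ}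
    (hσ : MemLp σ ⊤ μ) :
    ∃ C, ∀ p (L : E →L[ℝ] ℝ), ‖∫ z, σ z * (a p z * (𝐞 (L z) : ℂ)) ∂μ‖ ≤ C := by
  obtain ⟨C, -, hC⟩ := ha.bound
  refine ⟨lpNorm σ ⊤ μ * C * ∫ z, W z ∂μ, fun p L => ?_⟩
  rw [← integral_sub_right_eq_self W (c p), ← integral_const_mul]
  refine norm_integral_le_of_norm_le ((hW.comp_sub_right (c p)).const_mul _) ?_
  filter_upwards [ae_le_lpNorm_exponent_top hσ] with z hz
  rw [norm_mul, norm_mul, Circle.norm_coe, mul_one, mul_assoc]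
  exact mul_le_mul hz (by simpa only [norm_iteratedFDeriv_zero] using hC 0 (Nat.zero_le _) p z)
    (norm_nonneg _) lpNorm_nonneg

theorem exists_pow_mul_norm_integral_le [FiniteDimensional ℝ E] [μ.IsAddRightInvariant]
    (hW : Integrable W μ) {v : E} {σ : ℕ → E → ℂ} {k : ℕ} (hσ : ∀ j ≤ k, MemLp (σ j) ⊤ μ)
    (hweak : ∀ j < k, IsWeakDeriv μ v (σ j) (σ (j + 1)))
    (ha : HasUniformBounds k (fun p z => W (z - c p)) a) :
    ∃ C, ∀ p (L : E →L[ℝ] ℝ), |L v| ^ k * ‖∫ z, σ 0 z * (a p z * (𝐞 (L z) : ℂ)) ∂μ‖ ≤ C := by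
  induction k generalizing σ a with
  | zero => simpa only [pow_zero, one_mul] using ha.exists_norm_integral_le hW (hσ 0 le_rfl)
  | succ k ih =>
    obtain ⟨C, hC⟩ := ih (fun j hj => hσ (j + 1) (by lia)) (fun j hj => hweak (j + 1) (by lia))
      (ha.of_le k.le_succ)
    obtain ⟨C', hC'⟩ := ih (fun j hj => hσ j (by lia)) (fun j hj => hweak j (by lia))
      (ha.fderiv_apply v)
    refine ⟨C + C', fun p L => ?_⟩
    have hparts := (hweak 0 k.succ_pos).abs_mul_norm_integral_le (hσ 0 (Nat.zero_le _))
      (hσ 1 (by lia)) (ha.contDiff p) (ha.integrable hW p) ((ha.fderiv_apply v).integrable hW p) L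
    rw [pow_succ, mul_assoc]
    refine (mul_le_mul_of_nonneg_left hparts (by positivity)).trans ?_
    rw [mul_add]
    exact add_le_add (hC p L) (hC' p L)

end HasUniformBounds

end UniformBounds

section LinearRemainder

variable {E F : Type*} [NormedAddCommGroup E] [NormedSpace ℝ E] [NormedAddCommGroup F]
  [NormedSpace ℝ F] {f : E → F}

/-- The function `f` without the linear part of its Taylor expansion at `p`. The constant term is
kept: for a phase function it only contributes a unimodular factor. -/
noncomputable def linearRemainder (f : E → F) (p z : E) : F :=
  f z - fderiv ℝ f p z

theorem contDiff_linearRemainder (hf : ContDiff ℝ ∞ f) (p : E) :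
    ContDiff ℝ ∞ (linearRemainder f p) :=
  hf.sub (fderiv ℝ f p).contDiff

theorem fderiv_linearRemainder (hf : Differentiable ℝ f) (p : E) :
    fderiv ℝ (linearRemainder f p) = fun z => fderiv ℝ f z - fderiv ℝ f p :=
  funext fun z => ((hf z).hasFDerivAt.sub (fderiv ℝ f p).hasFDerivAt).fderiv

theorem norm_iteratedFDeriv_linearRemainder (hf : Differentiable ℝ f) (k : ℕ) (p z : E) :
    ‖iteratedFDeriv ℝ (k + 2) (linearRemainder f p) z‖ = ‖iteratedFDeriv ℝ (k + 2) f z‖ := by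
  have hfderiv : fderiv ℝ (fderiv ℝ (linearRemainder f p)) = fderiv ℝ (fderiv ℝ f) := by
    rw [fderiv_linearRemainder hf]
    exact funext fun z => fderiv_sub_const _
  simp only [← norm_iteratedFDeriv_fderiv, hfderiv]

namespace BoundedDerivsFrom

theorem exists_norm_iteratedFDeriv_le {n : ℕ} (hf : BoundedDerivsFrom n f) (K : ℕ) :
    ∃ C, ∀ k, n ≤ k → k ≤ K → ∀ x, ‖iteratedFDeriv ℝ k f x‖ ≤ C := by
  choose! C hC using hf.bounded
  exact ⟨∑ k ∈ Finset.range (K + 1), |C k|, fun k hnk hkK x =>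
    ((hC k hnk x).trans (le_abs_self _)).trans <|
      Finset.single_le_sum (f := fun k => |C k|) (fun _ _ => abs_nonneg _)
        (Finset.mem_range_succ_iff.2 hkK)⟩

theorem exists_norm_iteratedFDeriv_linearRemainder_le (hf : BoundedDerivsFrom 2 f) (K : ℕ) :
    ∃ B, 1 ≤ B ∧ ∀ k, 1 ≤ k → k ≤ K → ∀ p z,
      ‖iteratedFDeriv ℝ k (linearRemainder f p) z‖ ≤ B * (1 + ‖z - p‖) := by
  have hdiff := hf.contDiff.differentiable (by simp)
  obtain ⟨L, hL⟩ := hf.fderiv_right.exists_lipschitzWith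
  obtain ⟨C, hC⟩ := hf.exists_norm_iteratedFDeriv_le K
  have hB : 1 ≤ 1 + L + |C| := by
    linarith [L.coe_nonneg, abs_nonneg C]
  refine ⟨1 + L + |C|, hB, fun k hk hkK p z => ?_⟩
  obtain rfl | hk := hk.eq_or_lt
  · rw [norm_iteratedFDeriv_one, fderiv_linearRemainder hdiff]
    refine (hL.norm_sub_le z p).trans ?_
    gcongr
    · linarith [abs_nonneg C]
    · linarith
  · obtain ⟨j, rfl⟩ := Nat.exists_eq_add_of_le' hk
    rw [norm_iteratedFDeriv_linearRemainder hdiff]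
    calc ‖iteratedFDeriv ℝ (j + 2) f z‖ ≤ 1 + L + |C| := by
          linarith [hC (j + 2) hk hkK z, le_abs_self C, L.coe_nonneg]
      _ ≤ (1 + L + |C|) * (1 + ‖z - p‖) :=
          le_mul_of_one_le_right (by linarith) (by linarith [norm_nonneg (z - p)])

theorem hasUniformBounds_fourierChar_linearRemainder {φ : E → ℝ} (hφ : BoundedDerivsFrom 2 φ)
    (K : ℕ) : HasUniformBounds K (fun p z => (1 + ‖z - p‖) ^ K)
      (fun p z => (𝐞 (linearRemainder φ p z) : ℂ)) := by
  obtain ⟨B, hB1, hB⟩ := hφ.exists_norm_iteratedFDeriv_linearRemainder_le K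
  have hsmooth := contDiff_linearRemainder hφ.contDiff
  refine ⟨fun p => contDiff_fourierChar.comp (hsmooth p),
    K.factorial * (2 * Real.pi) ^ K * B ^ K, by positivity, fun k hk p z => ?_⟩
  have hD : 1 ≤ B * (1 + ‖z - p‖) :=
    one_le_mul_of_one_le_of_one_le hB1 (by linarith [norm_nonneg (z - p)])
  have hchar (i : ℕ) (hi : i ≤ k) :
      ‖iteratedFDeriv ℝ i (fun t => (𝐞 t : ℂ)) (linearRemainder φ p z)‖ ≤ (2 * Real.pi) ^ K := by
    rw [norm_iteratedFDeriv_fourierChar]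
    exact pow_le_pow_right₀ one_le_two_pi (hi.trans hk)
  calc ‖iteratedFDeriv ℝ k (fun z => (𝐞 (linearRemainder φ p z) : ℂ)) z‖
      ≤ k.factorial * (2 * Real.pi) ^ K * (B * (1 + ‖z - p‖)) ^ k :=
        norm_iteratedFDeriv_comp_le contDiff_fourierChar (hsmooth p) (by exact_mod_cast le_top) z
          hchar fun i hi hik =>
            (hB i hi (hik.trans hk) p z).trans (le_self_pow₀ hD (Nat.one_le_iff_ne_zero.1 hi))
    _ ≤ K.factorial * (2 * Real.pi) ^ K * (B * (1 + ‖z - p‖)) ^ K := by gcongr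
    _ = K.factorial * (2 * Real.pi) ^ K * B ^ K * (1 + ‖z - p‖) ^ K := by
        rw [mul_pow B, mul_assoc _ (B ^ K)]

end BoundedDerivsFrom

end LinearRemainder

section SchwartzWindows

variable {E F G : Type*} [NormedAddCommGroup E] [NormedSpace ℝ E] [NormedAddCommGroup F]
  [NormedSpace ℝ F] [NormedAddCommGroup G] [NormedSpace ℝ G]

theorem hasUniformBounds_schwartzMap_comp_sub (g : SchwartzMap F G) {P : E →L[ℝ] F}
    (hP : ‖P‖ ≤ 1) (K M : ℕ) :
    HasUniformBounds K (fun p z => ((1 + ‖P (z - p)‖) ^ M)⁻¹) (fun p z => g (P (z - p))) := by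
  refine ⟨fun p => (g.smooth ⊤).comp (P.contDiff.comp (contDiff_id.sub contDiff_const)),
    2 ^ M * ((Finset.Iic (M, K)).sup fun m => SchwartzMap.seminorm ℝ m.1 m.2) g, by positivity,
    fun k hk p z => ?_⟩
  rw [iteratedFDeriv_comp_sub (f := fun z => g (P z))]
  calc ‖iteratedFDeriv ℝ k (g ∘ P) (z - p)‖ ≤ ‖iteratedFDeriv ℝ k g (P (z - p))‖ := by
        rw [P.iteratedFDeriv_comp_right (g.smooth ⊤) _ (by exact_mod_cast le_top)]
        refine (ContinuousMultilinearMap.norm_compContinuousLinearMap_le _ _).trans ?_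
        exact mul_le_of_le_one_right (norm_nonneg _)
          (Finset.prod_le_one (fun _ _ => norm_nonneg _) fun _ _ => hP)
    _ ≤ _ := by
        rw [← div_eq_mul_inv, le_div_iff₀ (by positivity), mul_comm]
        exact SchwartzMap.one_add_le_sup_seminorm_apply (𝕜 := ℝ) (m := (M, K)) le_rfl hk g _

theorem one_add_norm_le_mul {X Y : Type*} [SeminormedAddCommGroup X] [SeminormedAddCommGroup Y]
    (z : X × Y) : 1 + ‖z‖ ≤ (1 + ‖z.1‖) * (1 + ‖z.2‖) := by
  have hz : ‖z‖ ≤ ‖z.1‖ + ‖z.2‖ :=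
    max_le (le_add_of_nonneg_right (norm_nonneg _)) (le_add_of_nonneg_left (norm_nonneg _))
  linarith [mul_nonneg (norm_nonneg z.1) (norm_nonneg z.2)]

theorem integrable_inv_one_add_norm_pow [FiniteDimensional ℝ E] [MeasurableSpace E] [BorelSpace E]
    {μ : Measure E} [μ.IsAddHaarMeasure] {M : ℕ} (hM : Module.finrank ℝ E < M) :
    Integrable (fun z : E => ((1 + ‖z‖) ^ M)⁻¹) μ := by
  refine (integrable_one_add_norm (r := M) (by exact_mod_cast hM)).congr (.of_forall fun z => ?_)
  simp only [Real.rpow_neg (by positivity : (0 : ℝ) ≤ 1 + ‖z‖), Real.rpow_natCast]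

end SchwartzWindows

section Amplitude

variable {d : ℕ} {Φ : Phase d → ℝ}

/-- The smooth factor of the phase-space integral of a matrix coefficient with windows `g`, `γ`.
The linear part of the phase at `p` is split off, so that all derivatives are controlled by the
distance to `p`. -/
noncomputable def amplitude (Φ : Phase d → ℝ) (g γ : SchwartzMap (Eu d) ℂ) (p z : Phase d) : ℂ :=
  (𝐞 (linearRemainder Φ p z) : ℂ) * ((starRingEnd ℂ) (γ (z.1 - p.1)) * 𝓕 g (z.2 - p.2))

theorem IsPhase.hasUniformBounds_amplitude (hΦ : IsPhase Φ) (g γ : SchwartzMap (Eu d) ℂ)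
    (K M : ℕ) :
    HasUniformBounds K (fun p z => ((1 + ‖z - p‖) ^ M)⁻¹) (amplitude Φ g γ) := by
  have hγ := (hasUniformBounds_schwartzMap_comp_sub γ
    (ContinuousLinearMap.norm_fst_le ℝ (Eu d) (Eu d)) K (K + M)).linearIsometryEquiv_comp
      Complex.conjLIE
  have hg := hasUniformBounds_schwartzMap_comp_sub (𝓕 g)
    (ContinuousLinearMap.norm_snd_le ℝ (Eu d) (Eu d)) K (K + M)
  have hosc := hΦ.boundedDerivsFrom.hasUniformBounds_fourierChar_linearRemainder K
  refine (hosc.mul (hγ.mul hg (fun p z => by positivity) fun p z => by positivity)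
    (fun p z => by positivity) fun p z => by positivity).mono fun p z => ?_
  rw [ContinuousLinearMap.coe_fst', ContinuousLinearMap.coe_snd', ← mul_inv, ← mul_pow]
  calc (1 + ‖z - p‖) ^ K * (((1 + ‖(z - p).1‖) * (1 + ‖(z - p).2‖)) ^ (K + M))⁻¹
      ≤ (1 + ‖z - p‖) ^ K * ((1 + ‖z - p‖) ^ (K + M))⁻¹ := by
        gcongr
        exact one_add_norm_le_mul _
    _ = ((1 + ‖z - p‖) ^ M)⁻¹ := by
        rw [pow_add]
        field_simp

end Amplitude

section WeakPartial

variable {d : ℕ} {σ : Phase d → ℂ} {i : Fin d ⊕ Fin d} {K : ℕ}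

theorem IsWeakPartial.isWeakDeriv {j : ℕ} {w w' : Phase d → ℂ}
    (hw : IsWeakPartial (fun _ : Fin j => i) σ w)
    (hw' : IsWeakPartial (fun _ : Fin (j + 1) => i) σ w') :
    IsWeakDeriv volume (phaseVec i) w w' := by
  intro φ hφ hφc
  have hfφ : ContDiff ℝ ∞ (fderiv ℝ φ) := hφ.fderiv_right (by simp)
  have hparts := hw (fun z => fderiv ℝ φ z (phaseVec i)) (hfφ.clm_apply contDiff_const)
    (hφc.fderiv_apply ℝ _)
  have hparts' := hw' φ hφ hφc
  have hiter (z : Phase d) : iteratedFDeriv ℝ (j + 1) φ z (fun _ => phaseVec i) =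
      iteratedFDeriv ℝ j (fun z => fderiv ℝ φ z (phaseVec i)) z (fun _ => phaseVec i) := by
    rw [iteratedFDeriv_succ_apply_right,
      iteratedFDeriv_clm_apply_const_apply hfφ (by exact_mod_cast le_top)]
    rfl
  simp only [hiter] at hparts'
  refine mul_left_cancel₀ (pow_ne_zero j (neg_ne_zero.2 (one_ne_zero' ℂ))) ?_
  rw [← hparts, hparts']
  ring

theorem IsSymbol.exists_isWeakDeriv (hσ : IsSymbol K σ) (i : Fin d ⊕ Fin d) :
    ∃ s : ℕ → Phase d → ℂ, s 0 = σ ∧ (∀ j ≤ K, MemLp (s j) ⊤ volume) ∧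
      ∀ j < K, IsWeakDeriv volume (phaseVec i) (s j) (s (j + 1)) := by
  have hderiv (j : ℕ) (hj : j ≤ K) := hσ.2 j hj fun _ => i
  choose! w hmem hweak using hderiv
  let s (j : ℕ) : Phase d → ℂ := if j = 0 then σ else w j
  have hs : ∀ j ≤ K, MemLp (s j) ⊤ volume ∧ IsWeakPartial (fun _ : Fin j => i) σ (s j)
    | 0, _ => ⟨hσ.1, fun φ _ _ => by simp [s]⟩
    | j + 1, hj => ⟨hmem _ hj, hweak _ hj⟩
  exact ⟨s, rfl, fun j hj => (hs j hj).1, fun j hj => (hs j hj.le).2.isWeakDeriv (hs _ hj).2⟩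

end WeakPartial

section MatrixCoefficients

variable {d : ℕ} {Φ : Phase d → ℝ} {σ : Phase d → ℂ} {K : ℕ}

theorem exp_two_pi_I_mul (t : ℝ) : Complex.exp (2 * Real.pi * Complex.I * t) = 𝐞 t := by
  rw [Real.fourierChar_apply]
  push_cast
  ring_nf

theorem gaborAtom_apply (g : Eu d → ℂ) (m n t : Eu d) :
    gaborAtom g m n t = 𝐞 (inner ℝ n t) * g (t - m) :=
  congrArg (· * g (t - m)) (exp_two_pi_I_mul _)

theorem fourier_gaborAtom (g : Eu d → ℂ) (m n η : Eu d) :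
    𝓕 (gaborAtom g m n) η = 𝐞 (inner ℝ m (n - η)) * 𝓕 g (η - n) := by
  simp only [Real.fourier_eq, Circle.smul_def, smul_eq_mul]
  rw [← integral_const_mul, ← integral_add_right_eq_self _ m]
  congr 1 with t
  have hphase :
      -inner ℝ (t + m) η + inner ℝ n (t + m) = inner ℝ m (n - η) + -inner ℝ t (η - n) := by
    simp only [inner_add_left, inner_add_right, inner_sub_right, real_inner_comm n]
    ring
  rw [gaborAtom_apply, add_sub_cancel_right, ← mul_assoc, ← mul_assoc, ← Circle.coe_mul,
    ← Circle.coe_mul, ← AddChar.map_add_eq_mul, ← AddChar.map_add_eq_mul, hphase]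

/-- The linear phase in the phase-space integral of the matrix coefficient at `(m, n)`,
`(m', n')`. Its components measure the failure of `(m', n)` to solve the equations
`m = ∇_η Φ`, `n' = ∇_x Φ` generating the canonical transformation. -/
noncomputable def defect (Φ : Phase d → ℝ) (m n m' n' : Eu d) : Phase d →L[ℝ] ℝ :=
  fderiv ℝ Φ (m', n) - (innerSL ℝ n').coprod (innerSL ℝ m)

theorem defect_inl (hΦ : Differentiable ℝ Φ) (m n m' n' : Eu d) (i : Fin d) :
    defect Φ m n m' n' (phaseVec (Sum.inl i)) = (gradX Φ m' n - n') i := by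
  have hcoord := inner_rieszComp_left (.inl ℝ (Eu d) (Eu d)) (fderiv ℝ Φ (m', n)) (stdVec i)
  rw [gradX_eq_rieszComp hΦ]
  simp_all [defect, phaseVec, stdVec, EuclideanSpace.inner_single_right]

theorem defect_inr (hΦ : Differentiable ℝ Φ) (m n m' n' : Eu d) (i : Fin d) :
    defect Φ m n m' n' (phaseVec (Sum.inr i)) = (gradEta Φ m' n - m) i := by
  have hcoord := inner_rieszComp_left (.inr ℝ (Eu d) (Eu d)) (fderiv ℝ Φ (m', n)) (stdVec i)
  rw [gradEta_eq_rieszComp hΦ]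
  simp_all [defect, phaseVec, stdVec, EuclideanSpace.inner_single_right]

instance isAddHaarMeasure_volume_phase : (volume : Measure (Phase d)).IsAddHaarMeasure :=
  inferInstanceAs ((volume : Measure (Eu d)).prod volume).IsAddHaarMeasure

theorem integrable_inv_one_add_norm_pow_phase :
    Integrable fun z : Phase d => ((1 + ‖z‖) ^ (2 * d + 1))⁻¹ :=
  integrable_inv_one_add_norm_pow <| by
    rw [Module.finrank_prod, finrank_euclideanSpace_fin]
    lia

theorem IsPhase.pairing_fio_gaborAtom (hΦ : IsPhase Φ) (hσ : MemLp σ ⊤ volume)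
    (g γ : SchwartzMap (Eu d) ℂ) (m n m' n' : Eu d) :
    pairing (fio Φ σ (gaborAtom g m n)) (gaborAtom γ m' n') =
      𝐞 (inner ℝ m n) *
        ∫ z, σ z * (amplitude Φ g γ (m', n) z * (𝐞 (defect Φ m n m' n' z) : ℂ)) := by
  have hint : Integrable
      (fun z => σ z * (amplitude Φ g γ (m', n) z * (𝐞 (defect Φ m n m' n' z) : ℂ))) :=
    (integrable_mul_fourierChar ((hΦ.hasUniformBounds_amplitude g γ 0 (2 * d + 1)).integrable
      integrable_inv_one_add_norm_pow_phase _) _).mul_of_top_right hσ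
  have hphase (x η : Eu d) : Φ (x, η) + inner ℝ m (n - η) + -inner ℝ n' x =
      inner ℝ m n + linearRemainder Φ (m', n) (x, η) + defect Φ m n m' n' (x, η) := by
    simp only [inner_sub_right, linearRemainder, defect, sub_apply,
      ContinuousLinearMap.coprod_apply, coe_innerSL_apply]
    ring
  have hchar (x η : Eu d) := congrArg (fun t => (𝐞 t : ℂ)) (hphase x η)
  simp only [AddChar.map_add_eq_mul, Circle.coe_mul] at hchar
  rw [Measure.volume_eq_prod] at hint ⊢
  rw [integral_prod _ hint, ← integral_const_mul, pairing]
  congr 1 with x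
  rw [fio, ← integral_mul_const, ← integral_const_mul]
  congr 1 with η
  rw [exp_two_pi_I_mul, fourier_gaborAtom, gaborAtom_apply, map_mul, conj_fourierChar, amplitude,
    SchwartzMap.fourier_coe]
  linear_combination
    (σ (x, η) * 𝓕 (g : Eu d → ℂ) (η - n) * (starRingEnd ℂ) (γ (x - m'))) * hchar x η

theorem IsPhase.norm_pairing_fio_gaborAtom (hΦ : IsPhase Φ) (hσ : MemLp σ ⊤ volume)
    (g γ : SchwartzMap (Eu d) ℂ) (m n m' n' : Eu d) :
    ‖pairing (fio Φ σ (gaborAtom g m n)) (gaborAtom γ m' n')‖ =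
      ‖∫ z, σ z * (amplitude Φ g γ (m', n) z * (𝐞 (defect Φ m n m' n' z) : ℂ))‖ := by
  rw [hΦ.pairing_fio_gaborAtom hσ, norm_mul, Circle.norm_coe, one_mul]

theorem IsPhase.exists_norm_pairing_le (hΦ : IsPhase Φ) (hσ : MemLp σ ⊤ volume)
    (g γ : SchwartzMap (Eu d) ℂ) :
    ∃ C, ∀ m n m' n' : Eu d,
      ‖pairing (fio Φ σ (gaborAtom g m n)) (gaborAtom γ m' n')‖ ≤ C := by
  obtain ⟨C, hC⟩ := (hΦ.hasUniformBounds_amplitude g γ 0 (2 * d + 1)).exists_norm_integral_le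
    integrable_inv_one_add_norm_pow_phase hσ
  exact ⟨C, fun m n m' n' => (hΦ.norm_pairing_fio_gaborAtom hσ g γ m n m' n').trans_le (hC _ _)⟩

theorem IsPhase.exists_abs_defect_pow_mul_norm_pairing_le (hΦ : IsPhase Φ) (hσ : IsSymbol K σ)
    (g γ : SchwartzMap (Eu d) ℂ) (i : Fin d ⊕ Fin d) :
    ∃ C, ∀ m n m' n' : Eu d, |defect Φ m n m' n' (phaseVec i)| ^ K *
      ‖pairing (fio Φ σ (gaborAtom g m n)) (gaborAtom γ m' n')‖ ≤ C := by
  obtain ⟨s, rfl, hs, hweak⟩ := hσ.exists_isWeakDeriv i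
  obtain ⟨C, hC⟩ := (hΦ.hasUniformBounds_amplitude g γ K
    (2 * d + 1)).exists_pow_mul_norm_integral_le integrable_inv_one_add_norm_pow_phase hs hweak
  refine ⟨C, fun m n m' n' => ?_⟩
  rw [hΦ.norm_pairing_fio_gaborAtom hσ.1]
  exact hC _ _

theorem sum_pow_le_card_pow_mul_sum_pow {ι : Type*} [Fintype ι] [Nonempty ι] {t : ι → ℝ}
    (ht : ∀ i, 0 ≤ t i) (k : ℕ) : (∑ i, t i) ^ k ≤ (Fintype.card ι : ℝ) ^ k * ∑ i, t i ^ k := by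
  obtain ⟨j, hj⟩ := Finite.exists_max t
  calc (∑ i, t i) ^ k ≤ (Fintype.card ι * t j) ^ k := by
        refine pow_le_pow_left₀ (Finset.sum_nonneg fun i _ => ht i) ?_ k
        simpa using Finset.sum_le_card_nsmul Finset.univ t (t j) fun i _ => hj i
    _ ≤ (Fintype.card ι : ℝ) ^ k * ∑ i, t i ^ k := by
        rw [mul_pow]
        gcongr
        exact Finset.single_le_sum (f := fun i => t i ^ k) (fun i _ => pow_nonneg (ht i) k)
          (Finset.mem_univ j)

theorem IsPhase.exists_sum_abs_defect_pow_mul_norm_pairing_le (hΦ : IsPhase Φ)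
    (hσ : IsSymbol K σ) (g γ : SchwartzMap (Eu d) ℂ) :
    ∃ C, ∀ m n m' n' : Eu d, (1 + ∑ i, |defect Φ m n m' n' (phaseVec i)|) ^ K *
      ‖pairing (fio Φ σ (gaborAtom g m n)) (gaborAtom γ m' n')‖ ≤ C := by
  obtain ⟨C₀, hC₀⟩ := hΦ.exists_norm_pairing_le hσ.1 g γ
  choose C hC using hΦ.exists_abs_defect_pow_mul_norm_pairing_le hσ g γ
  refine ⟨Fintype.card (Option (Fin d ⊕ Fin d)) ^ K * (C₀ + ∑ i, C i), fun m n m' n' => ?_⟩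
  set P := ‖pairing (fio Φ σ (gaborAtom g m n)) (gaborAtom γ m' n')‖
  set t : Option (Fin d ⊕ Fin d) → ℝ :=
    fun o => o.elim 1 fun i => |defect Φ m n m' n' (phaseVec i)|
  have ht : ∀ o, 0 ≤ t o
    | none => zero_le_one
    | some _ => abs_nonneg _
  have hpow := sum_pow_le_card_pow_mul_sum_pow ht K
  simp only [Fintype.sum_option, t, Option.elim_none, Option.elim_some, one_pow] at hpow
  refine (mul_le_mul_of_nonneg_right hpow (norm_nonneg _)).trans ?_
  rw [mul_assoc, add_mul, one_mul, Finset.sum_mul]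
  gcongr with i
  · exact hC₀ m n m' n'
  · exact hC i m n m' n'

theorem norm_le_sum_abs (u : Eu d) : ‖u‖ ≤ ∑ i, |u i| :=
  (congrArg norm ((EuclideanSpace.basisFun (Fin d) ℝ).sum_repr u)).symm.trans_le <|
    (norm_sum_le _ _).trans_eq (by simp [norm_smul])

theorem bracket_pos (q : Phase d) : 0 < bracket q :=
  Real.sqrt_pos.2 (by positivity)

theorem bracket_le (q : Phase d) : bracket q ≤ 1 + 2 * ‖q‖ := by
  refine Real.sqrt_le_iff.2 ⟨by positivity, ?_⟩
  nlinarith [norm_fst_le q, norm_snd_le q, norm_nonneg q.1, norm_nonneg q.2, norm_nonneg q]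

theorem IsGeneratedBy.bracket_sub_le {χ : Phase d → Phase d} {L : NNReal}
    (hχ : IsGeneratedBy Φ χ) (hL : LipschitzWith L χ) (hΦ : Differentiable ℝ Φ)
    (m n m' n' : Eu d) :
    bracket (χ (m, n) - (m', n')) ≤
      2 * (L + 1) * (1 + ∑ i, |defect Φ m n m' n' (phaseVec i)|) := by
  rw [Fintype.sum_sum_type]
  simp only [defect_inl hΦ, defect_inr hΦ]
  have hX := norm_le_sum_abs (gradX Φ m' n - n')
  have hEta := norm_le_sum_abs (gradEta Φ m' n - m)
  set X := ∑ i, |(gradX Φ m' n - n') i|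
  set Eta := ∑ i, |(gradEta Φ m' n - m) i|
  have hX0 : 0 ≤ X := (norm_nonneg _).trans hX
  have hEta0 : 0 ≤ Eta := (norm_nonneg _).trans hEta
  calc bracket (χ (m, n) - (m', n')) ≤ 1 + 2 * ‖χ (m, n) - (m', n')‖ := bracket_le _
    _ ≤ 1 + 2 * (L * Eta + X) := by
        gcongr
        exact (hχ.norm_sub_le hL m n m' n').trans (by gcongr)
    _ ≤ 2 * (L + 1) * (1 + (X + Eta)) := by
        nlinarith [L.coe_nonneg, mul_nonneg L.coe_nonneg hX0]

end MatrixCoefficients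

end FourierOp

open FourierOp in
theorem theorem3p3_general {d : ℕ} (K : ℕ) {Φ : Phase d → ℝ} (hΦ : IsPhase Φ)
    {σ : Phase d → ℂ} (hσ : IsSymbol K σ) (g γ : SchwartzMap (Eu d) ℂ) :
    ∃ χ : Phase d ≃ Phase d, IsCanonicalTransformation χ ∧ IsGeneratedBy Φ χ ∧
      ∃ C : ℝ, 0 < C ∧ ∀ m n m' n' : Eu d,
        ‖pairing (fio Φ σ (gaborAtom g m n)) (gaborAtom γ m' n')‖ ≤
          C * bracket (χ (m, n) - (m', n')) ^ (-(K : ℤ)) := by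
  obtain ⟨χ, hχ, hgen⟩ := hΦ.exists_canonicalTransformation
  obtain ⟨L, hL⟩ := hχ.lipschitz
  obtain ⟨C, hC⟩ := hΦ.exists_sum_abs_defect_pow_mul_norm_pairing_le hσ g γ
  have hC0 : 0 ≤ C := le_trans (by positivity) (hC 0 0 0 0)
  refine ⟨χ, hχ, hgen, (2 * (L + 1)) ^ K * C + 1, by positivity, fun m n m' n' => ?_⟩
  have hbracket := bracket_pos (χ (m, n) - (m', n'))
  rw [zpow_neg, zpow_natCast, ← div_eq_mul_inv, le_div_iff₀ (by positivity), mul_comm]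
  set P := ‖pairing (fio Φ σ (gaborAtom g m n)) (gaborAtom γ m' n')‖
  calc bracket (χ (m, n) - (m', n')) ^ K * P
      ≤ (2 * (L + 1) * (1 + ∑ i, |defect Φ m n m' n' (phaseVec i)|)) ^ K * P := by
        gcongr
        exact hgen.bracket_sub_le hL hΦ.differentiable m n m' n'
    _ = (2 * (L + 1)) ^ K * ((1 + ∑ i, |defect Φ m n m' n' (phaseVec i)|) ^ K * P) := by
        rw [mul_pow, mul_assoc]
    _ ≤ (2 * (L + 1)) ^ K * C + 1 := by
        linarith [mul_le_mul_of_nonneg_left (hC m n m' n')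
          (by positivity : (0 : ℝ) ≤ (2 * (L + 1)) ^ K)]

theorem theorem3p3 {d : ℕ} (N : ℕ) (Φ : FourierOp.Phase d → ℝ) (hΦ : FourierOp.IsPhase Φ)
    (σ : FourierOp.Phase d → ℂ) (hσ : FourierOp.IsSymbol (2 * N) σ)
    (g : SchwartzMap (FourierOp.Eu d) ℂ) (a b : ℝ) (ha : 0 < a) (hb : 0 < b) :
    ∃ χ : FourierOp.Phase d ≃ FourierOp.Phase d,
      FourierOp.IsCanonicalTransformation χ ∧ FourierOp.IsGeneratedBy Φ χ ∧
      ∃ C : ℝ, 0 < C ∧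
        ∀ m n m' n' : FourierOp.Eu d,
          (m, n) ∈ FourierOp.gaborLattice d a b → (m', n') ∈ FourierOp.gaborLattice d a b →
          ‖FourierOp.pairing (FourierOp.fio Φ σ (FourierOp.gaborAtom g m n)) (FourierOp.gaborAtom g m' n')‖
            ≤ C * FourierOp.bracket (χ (m, n) - (m', n')) ^ (-(2 * (N : ℤ))) := by
  obtain ⟨χ, hχ, hgen, C, hC0, hC⟩ := theorem3p3_general (2 * N) hΦ hσ g g
  exact ⟨χ, hχ, hgen, C, hC0, fun m n m' n' _ _ => by exact_mod_cast hC m n m' n'⟩
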